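/- Let $\mathbb{T}\subseteq\mathbb{R}$ and, for each $x\in\mathbb{T}$, let $\mathbb{S}_x\subseteq\mathbb{R}$. Assume that these sets are discrete uniformly in the target: there is a constant $\alpha>0$, not depending on $x$, such that $|z-x|\ge\alpha$ for all $x\in\mathbb{T}$ and all $z\in(\mathbb{T}\cup\mathbb{S}_x)\setminus\{x\}$. Let $f$ be a probability mass function (pmf) supported in $\mathbb{T}$ and let $X_1,X_2,\ldots$ be i.i.d. random variables with pmf $f$. For every $x\in\mathbb{T}$ and $h>0$ let $K_{x,h}$ be a pmf supported in $\mathbb{S}_x$, and let $Z_{x,h}$ be a random variable with pmf $K_{x,h}$. Let $(h_n)_{n\ge1}$ be a sequence of positive numbers, and put $$\widetilde f_n(x)=\frac1n\sum_{i=1}^nK_{x,h_n}(X_i),\qquad C_n=\sum_{x\in\mathbb{T}}\widetilde f_n(x),\qquad \widehat f_n(x)=\frac{\widetilde f_n(x)}{C_n},\qquad x\in\mathbb{T}$$ (with the convention $\widehat f_n(x)=0$ when $C_n\in\{0,\infty\}$). Assume **(A2)** $x\in\mathbb{S}_x$ for all $x\in\mathbb{T}$, and, as $n\to\infty$, $$\sup_{x\in\mathbb{T}}\left|\mathbb{E}(Z_{x,h_n})-x\right|=\mathcal{O}(h_n)\quad\text{and}\quad\sup_{x\in\mathbb{T}}\mathrm{Var}(Z_{x,h_n})=\mathcal{O}(h_n)$$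 (in particular, for all large $n$, $Z_{x,h_n}$ has a finite second moment for every $x\in\mathbb{T}$). If $\sqrt n\,h_n\to0$ as $n\to\infty$, then for every $x\in\mathbb{T}$ with $f(x)>0$, the sequence $\sqrt n\,(\widehat f_n(x)-f(x))$ converges in distribution, as $n\to\infty$, to the normal distribution $\mathcal{N}(0,f(x)\{1-f(x)\})$ (the point mass at $0$ if $f(x)=1$). -/

import Mathlib

open MeasureTheory ProbabilityTheory Filter Topology

noncomputable section

namespace DiscreteKernel

/-- The discreteness of the target set `T` and of the kernel supports `S x`: there is a constant
`α > 0`, not depending on the target `x ∈ T`, such that every point of `T ∪ S x` other than `x`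
is at distance at least `α` from `x`. -/
def UniformlyDiscrete (T : Set ℝ) (S : ℝ → Set ℝ) : Prop :=
  ∃ α : ℝ, 0 < α ∧ ∀ x ∈ T, ∀ z ∈ (T ∪ S x) \ {x}, α ≤ |z - x|

/-- `K x h` is a pmf on the support `S x`, for every target `x ∈ T` and bandwidth `h > 0`. -/
def IsKernelOn (T : Set ℝ) (S : ℝ → Set ℝ) (K : ℝ → ℝ → PMF ℝ) : Prop :=
  ∀ x ∈ T, ∀ h : ℝ, 0 < h → (K x h).support ⊆ S x

/-- The mean `E(Z_{x,h})` of a random variable with pmf `K x h`. -/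
def kernelMean (K : ℝ → ℝ → PMF ℝ) (x h : ℝ) : ℝ := ∫ z, z ∂(K x h).toMeasure

/-- The variance `Var(Z_{x,h})` of a random variable with pmf `K x h`. -/
def kernelVar (K : ℝ → ℝ → PMF ℝ) (x h : ℝ) : ℝ := Var[fun z : ℝ => z; (K x h).toMeasure]

/-- `x ∈ S x` for every target `x`, and `sup_{x ∈ T} |E(Z_{x,h_n}) - x| = O(h_n)` and
`sup_{x ∈ T} Var(Z_{x,h_n}) = O(h_n)` as `n → ∞`. The field `moment` says that the means and
variances in question exist (as finite numbers) for all large `n`. -/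
structure AssumptionA2 (T : Set ℝ) (S : ℝ → Set ℝ) (K : ℝ → ℝ → PMF ℝ) (h : ℕ → ℝ) : Prop where
  mem_support : ∀ x ∈ T, x ∈ S x
  moment : ∀ᶠ n in atTop, ∀ x ∈ T, MemLp (fun z : ℝ => z) 2 (K x (h n)).toMeasure
  bias : ∃ c : ℝ, ∀ᶠ n in atTop, ∀ x ∈ T, |kernelMean K x (h n) - x| ≤ c * h n
  variance : ∃ c : ℝ, ∀ᶠ n in atTop, ∀ x ∈ T, kernelVar K x (h n) ≤ c * h n

/-- The non-normalized estimator `(1/n) ∑_{i=1}^n K_{x,h_n}(X_i)`; the sample `X_1, …, X_n` is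
indexed here by `0, …, n - 1`. -/
def fTilde {Ω : Type*} (K : ℝ → ℝ → PMF ℝ) (h : ℕ → ℝ) (X : ℕ → Ω → ℝ)
    (n : ℕ) (x : ℝ) (ω : Ω) : ℝ :=
  (1 / (n : ℝ)) * ∑ i ∈ Finset.range n, (K x (h n) (X i ω)).toReal

/-- The normalizing random variable, the sum of the non-normalized estimator over all targets. -/
def normConst {Ω : Type*} (T : Set ℝ) (K : ℝ → ℝ → PMF ℝ) (h : ℕ → ℝ) (X : ℕ → Ω → ℝ)
    (n : ℕ) (ω : Ω) : ℝ :=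
  ∑' x : T, fTilde K h X n x ω

/-- The normalized estimator. -/
def fHat {Ω : Type*} (T : Set ℝ) (K : ℝ → ℝ → PMF ℝ) (h : ℕ → ℝ) (X : ℕ → Ω → ℝ)
    (n : ℕ) (x : ℝ) (ω : Ω) : ℝ :=
  fTilde K h X n x ω / normConst T K h X n ω

end DiscreteKernel

end

/-!
A kernel with small second moment around its target is close to the point mass there: by
Chebyshev, `1 - K_{y,h}(y)` and `(z - y)² K_{y,h}(z)` are at most a multiple of that moment, which
under (A2) is `O(h)`. The first bound replaces `f̃_n` by the empirical frequency of `x`. The second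
one, summed over the uniformly separated targets like the series of `1 / k²`, shows that the
targets together give mass `1 + O(h)` to every observation, so that `C_n = 1 + O(h)` as well. Hence
`f̂_n(x)` differs from the empirical frequency by `O(h_n) = o(1 / √n)`, and the classical central
limit theorem for frequencies carries over.
-/

namespace DiscreteKernel

section Separated

variable {T : Set ℝ} {α : ℝ}

lemma injective_floor_sub_div (hα : 0 < α) (hT : T.Pairwise fun y z => α ≤ |z - y|) (z : ℝ) :
    Function.Injective fun y : T => ⌊((y : ℝ) - z) / α⌋ := by
  intro y y' hfloor
  by_contra hne
  have hlt := Int.abs_sub_lt_one_of_floor_eq_floor hfloor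
  rw [← sub_div, sub_sub_sub_cancel_right, abs_div, abs_of_pos hα, div_lt_one hα] at hlt
  exact hlt.not_ge (hT y'.2 y.2 fun h => hne (Subtype.ext h.symm))

lemma countable_of_pairwise_le_abs_sub (hα : 0 < α) (hT : T.Pairwise fun y z => α ≤ |z - y|) :
    T.Countable :=
  Set.countable_coe_iff.1 (injective_floor_sub_div hα hT 0).countable

lemma inv_sq_le_four_mul_inv_floor_sq {u : ℝ} (hu : 1 ≤ |u|) :
    (u ^ 2)⁻¹ ≤ 4 * ((⌊u⌋ : ℝ) ^ 2)⁻¹ := by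
  have hle := Int.floor_le u
  have hlt := Int.lt_floor_add_one u
  have hfloor : (⌊u⌋ : ℝ) ≠ 0 := by
    intro h0
    rw [h0] at hle hlt
    rw [abs_of_nonneg hle] at hu
    linarith
  have habs : |(⌊u⌋ : ℝ)| ≤ |2 * u| := by
    rw [abs_mul, abs_two]
    rcases abs_cases u with h | h <;> rcases abs_cases (⌊u⌋ : ℝ) with h' | h' <;> linarith
  have hu0 : u ≠ 0 := abs_pos.1 (zero_lt_one.trans_le hu)
  rw [← div_eq_mul_inv, inv_le_comm₀ (by positivity) (by positivity), inv_div,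
    div_le_iff₀ four_pos]
  linarith [sq_le_sq.2 habs]

/-- The term `y = z` of the sum is `0⁻¹ = 0`. -/
lemma exists_tsum_inv_sub_sq_le (hα : 0 < α) (hT : T.Pairwise fun y z => α ≤ |z - y|) :
    ∃ C : ℝ, ∀ z ∈ T, Summable (fun y : T => (((y : ℝ) - z) ^ 2)⁻¹) ∧
      ∑' y : T, (((y : ℝ) - z) ^ 2)⁻¹ ≤ C := by
  set w : ℤ → ℝ := fun j => 4 / α ^ 2 * ((j : ℝ) ^ 2)⁻¹ with hw
  have hw_summable : Summable w := by
    simpa only [hw, one_div] using (Real.summable_one_div_int_pow.2 one_lt_two).mul_left (4 / α ^ 2)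
  have hw_nonneg : ∀ j, 0 ≤ w j := fun j => by positivity
  refine ⟨∑' j, w j, fun z hz => ?_⟩
  have hinj := injective_floor_sub_div hα hT z
  have hle : ∀ y : T, (((y : ℝ) - z) ^ 2)⁻¹ ≤ w ⌊((y : ℝ) - z) / α⌋ := by
    intro y
    rcases eq_or_ne (y : ℝ) z with hyz | hyz
    · simp [hyz, hw]
    · have hscaled : 1 ≤ |((y : ℝ) - z) / α| := by
        rw [abs_div, abs_of_pos hα, one_le_div hα]
        exact hT hz y.2 hyz.symm
      calc (((y : ℝ) - z) ^ 2)⁻¹ = (α ^ 2)⁻¹ * ((((y : ℝ) - z) / α) ^ 2)⁻¹ := by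
            rw [div_pow]
            field_simp
        _ ≤ (α ^ 2)⁻¹ * (4 * ((⌊((y : ℝ) - z) / α⌋ : ℝ) ^ 2)⁻¹) := by
            gcongr
            exact inv_sq_le_four_mul_inv_floor_sq hscaled
        _ = w ⌊((y : ℝ) - z) / α⌋ := by
            rw [hw]
            ring
  have hfloor_summable := hw_summable.comp_injective hinj
  have hsummable := Summable.of_nonneg_of_le (fun y => by positivity) hle hfloor_summable
  exact ⟨hsummable, (hsummable.tsum_le_tsum hle hfloor_summable).trans
    (tsum_comp_le_tsum_of_inj hw_summable hw_nonneg hinj)⟩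

lemma UniformlyDiscrete.exists_pairwise {S : ℝ → Set ℝ} (hTS : UniformlyDiscrete T S) :
    ∃ α : ℝ, 0 < α ∧ (T.Pairwise fun y z => α ≤ |z - y|) ∧
      ∀ y ∈ T, ∀ z ∈ S y, z ≠ y → α ≤ |z - y| := by
  obtain ⟨α, hα, hsep⟩ := hTS
  exact ⟨α, hα, fun y hy z hz hne => hsep y hy z ⟨Or.inl hz, hne.symm⟩,
    fun y hy z hz hne => hsep y hy z ⟨Or.inr hz, hne⟩⟩

end Separated

section SecondMoment

/-- The second moment of `μ` around `y` exists and is at most `D`. Integrability is part of the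
notion because the integral of a non-integrable function is `0`. -/
def SecondMomentLE (μ : Measure ℝ) (y D : ℝ) : Prop :=
  Integrable (fun z => (z - y) ^ 2) μ ∧ ∫ z, (z - y) ^ 2 ∂μ ≤ D

variable {μ : Measure ℝ} {y D : ℝ}

lemma SecondMomentLE.mono {D' : ℝ} (hμ : SecondMomentLE μ y D) (hD : D ≤ D') :
    SecondMomentLE μ y D' :=
  ⟨hμ.1, hμ.2.trans hD⟩

lemma secondMomentLE_variance_add_sq [IsProbabilityMeasure μ] (hμ : MemLp (fun z : ℝ => z) 2 μ)
    (y : ℝ) : SecondMomentLE μ y (Var[fun z : ℝ => z; μ] + (∫ z, z ∂μ - y) ^ 2) := by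
  have hsub : MemLp (fun z : ℝ => z - y) 2 μ := hμ.sub (memLp_const y)
  have hmean : ∫ z, (z - y) ∂μ = ∫ z, z ∂μ - y := by
    rw [integral_sub (hμ.integrable one_le_two) (integrable_const y)]
    simp
  have hvar := variance_eq_sub hsub
  rw [variance_sub_const hμ.aestronglyMeasurable, hmean] at hvar
  exact ⟨hsub.integrable_sq, (eq_add_of_sub_eq hvar.symm).le⟩

lemma SecondMomentLE.sq_mul_measureReal_le [IsFiniteMeasure μ] (hμ : SecondMomentLE μ y D)
    {s : Set ℝ} {c : ℝ} (hc : 0 ≤ c) (hs : ∀ᵐ z ∂μ, z ∈ s → c ≤ |z - y|) :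
    c ^ 2 * μ.real s ≤ D := by
  have hsub : s ≤ᵐ[μ] {z | c ^ 2 ≤ (z - y) ^ 2} := by
    filter_upwards [hs] with z hz hzs
    exact sq_le_sq.2 ((abs_of_nonneg hc).le.trans (hz hzs))
  calc c ^ 2 * μ.real s ≤ c ^ 2 * μ.real {z | c ^ 2 ≤ (z - y) ^ 2} :=
        mul_le_mul_of_nonneg_left (ENNReal.toReal_mono (measure_ne_top _ _) (measure_mono_ae hsub))
          (sq_nonneg c)
    _ ≤ ∫ z, (z - y) ^ 2 ∂μ :=
        mul_meas_ge_le_integral_of_nonneg (ae_of_all _ fun z => sq_nonneg (z - y)) hμ.1 _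
    _ ≤ D := hμ.2

end SecondMoment

section PMF

variable {β : Type*} [MeasurableSpace β] [MeasurableSingletonClass β]

lemma measurable_pmf (k : PMF β) : Measurable k :=
  measurable_zero.measurable_of_countable_ne <| k.support_countable.mono fun _ hz => hz.symm

lemma measureReal_toMeasure_singleton (k : PMF β) (z : β) :
    k.toMeasure.real {z} = (k z).toReal := by
  rw [measureReal_def, k.toMeasure_apply_singleton z (measurableSet_singleton z)]

lemma measureReal_toMeasure_compl_singleton (k : PMF β) (y : β) :
    k.toMeasure.real {y}ᶜ = 1 - (k y).toReal := by
  rw [probReal_compl_eq_one_sub (measurableSet_singleton y), measureReal_toMeasure_singleton]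

lemma ae_mem_support (k : PMF β) : ∀ᵐ z ∂k.toMeasure, z ∈ k.support := by
  rw [← k.restrict_toMeasure_support]
  exact ae_restrict_mem k.support_countable.measurableSet

lemma ae_forall_mem_of_support_subset {Ω ι : Type*} [MeasurableSpace Ω] [Countable ι]
    {P : Measure Ω} {X : ι → Ω → β} {f : PMF β} {T : Set β}
    (hX : ∀ i, HasLaw (X i) f.toMeasure P) (hf : f.support ⊆ T) : ∀ᵐ ω ∂P, ∀ i, X i ω ∈ T := by
  refine ae_all_iff.2 fun i => ae_of_ae_map (p := fun z => z ∈ T) (hX i).aemeasurable ?_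
  rw [(hX i).map_eq]
  exact (ae_mem_support f).mono fun z hz => hf hz

lemma abs_apply_sub_indicator_le (k : PMF β) (y z : β) :
    |(k z).toReal - ({y} : Set β).indicator 1 z| ≤ 1 - (k y).toReal := by
  rw [← measureReal_toMeasure_compl_singleton]
  rcases eq_or_ne z y with rfl | hzy
  · rw [Set.indicator_of_mem (Set.mem_singleton z), Pi.one_apply, abs_sub_comm,
      ← measureReal_toMeasure_compl_singleton, abs_of_nonneg measureReal_nonneg]
  · rw [Set.indicator_of_notMem (by simpa using hzy), sub_zero, ← measureReal_toMeasure_singleton,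
      abs_of_nonneg measureReal_nonneg]
    exact measureReal_mono (by simpa using hzy.symm)

end PMF

section Kernel

variable {y z D : ℝ}

lemma SecondMomentLE.one_sub_apply_le {k : PMF ℝ} (hk : SecondMomentLE k.toMeasure y D) {α : ℝ}
    (hα : 0 < α) (hsep : ∀ z ∈ k.support, z ≠ y → α ≤ |z - y|) :
    1 - (k y).toReal ≤ D / α ^ 2 := by
  rw [← measureReal_toMeasure_compl_singleton, le_div_iff₀' (by positivity)]
  exact hk.sq_mul_measureReal_le hα.le ((ae_mem_support k).mono hsep)

lemma SecondMomentLE.apply_le {k : PMF ℝ} (hk : SecondMomentLE k.toMeasure y D) (hyz : y ≠ z) :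
    (k z).toReal ≤ D * ((y - z) ^ 2)⁻¹ := by
  have hpos : 0 < (y - z) ^ 2 := sq_pos_of_ne_zero (sub_ne_zero.2 hyz)
  rw [← measureReal_toMeasure_singleton, ← div_eq_mul_inv, le_div_iff₀' hpos, ← sq_abs,
    abs_sub_comm]
  exact hk.sq_mul_measureReal_le (abs_nonneg _) (ae_of_all _ fun w hw => by
    rw [Set.mem_singleton_iff.1 hw])

lemma summable_and_abs_tsum_apply_sub_one_le {T : Set ℝ} {k : ℝ → PMF ℝ} {E : ℝ} (hz : z ∈ T)
    (hT : Summable fun y : T => (((y : ℝ) - z) ^ 2)⁻¹) (hdiag : 1 - (k z z).toReal ≤ E)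
    (hoff : ∀ y ∈ T, y ≠ z → (k y z).toReal ≤ D * ((y - z) ^ 2)⁻¹) :
    Summable (fun y : T => (k y z).toReal) ∧
      |∑' y : T, (k y z).toReal - 1| ≤ E + D * ∑' y : T, (((y : ℝ) - z) ^ 2)⁻¹ := by
  classical
  have hone := hasSum_ite_eq (⟨z, hz⟩ : T) (1 : ℝ)
  have hdom := (hasSum_ite_eq (⟨z, hz⟩ : T) E).add (hT.hasSum.mul_left D)
  have hle : ∀ y : T, ‖(k y z).toReal - if y = ⟨z, hz⟩ then (1 : ℝ) else 0‖ ≤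
      (if y = ⟨z, hz⟩ then E else 0) + D * (((y : ℝ) - z) ^ 2)⁻¹ := by
    intro y
    split_ifs with hy
    · have := abs_apply_sub_indicator_le (k z) z z
      simp only [Set.indicator_of_mem (Set.mem_singleton z), Pi.one_apply] at this
      simpa [hy] using this.trans hdiag
    · simpa using hoff y y.2 fun h => hy (Subtype.ext h)
  have hsummable : Summable fun y : T => (k y z).toReal := by
    simpa using (hdom.summable.of_norm_bounded hle).add hone.summable
  refine ⟨hsummable, ?_⟩
  rw [← hone.tsum_eq, ← hsummable.tsum_sub hone.summable]
  exact tsum_of_norm_bounded hdom hle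

end Kernel

section RealEstimates

lemma abs_average_sub_average_le {a b : ℕ → ℝ} {E : ℝ} (hab : ∀ i, |a i - b i| ≤ E) (n : ℕ) :
    |1 / (n : ℝ) * ∑ i ∈ Finset.range n, a i - 1 / (n : ℝ) * ∑ i ∈ Finset.range n, b i| ≤ E := by
  have hE : 0 ≤ E := (abs_nonneg _).trans (hab 0)
  rw [← mul_sub, ← Finset.sum_sub_distrib, abs_mul, abs_of_nonneg (by positivity)]
  calc 1 / (n : ℝ) * |∑ i ∈ Finset.range n, (a i - b i)|
      ≤ 1 / (n : ℝ) * ∑ _i ∈ Finset.range n, E := by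
        gcongr
        exact (Finset.abs_sum_le_sum_abs _ _).trans (Finset.sum_le_sum fun i _ => hab i)
    _ = (n : ℝ) / n * E := by
        rw [Finset.sum_const, Finset.card_range, nsmul_eq_mul]
        ring
    _ ≤ E := mul_le_of_le_one_left hE (div_self_le_one _)

lemma abs_div_sub_le {a c p E F : ℝ} (hp : |p| ≤ 1) (ha : |a - p| ≤ E) (hc : |c - 1| ≤ F)
    (hF : F ≤ 1 / 2) : |a / c - p| ≤ 2 * (E + F) := by
  have hc2 : 1 / 2 ≤ c := by linarith [(abs_le.1 hc).1]
  have hc0 : 0 < c := by linarith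
  have hsum : 0 ≤ E + F := add_nonneg ((abs_nonneg _).trans ha) ((abs_nonneg _).trans hc)
  have hdecomp : a / c - p = ((a - p) - p * (c - 1)) / c := by
    field_simp
    ring
  rw [hdecomp, abs_div, abs_of_pos hc0, div_le_iff₀ hc0]
  calc |a - p - p * (c - 1)| ≤ |a - p| + |p * (c - 1)| := abs_sub _ _
    _ ≤ E + F := by
        rw [abs_mul]
        exact add_le_add ha ((mul_le_of_le_one_left (abs_nonneg _) hp).trans hc)
    _ ≤ 2 * (E + F) * c := by nlinarith

lemma tendsto_zero_of_sqrt_mul_tendsto_zero {a : ℕ → ℝ}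
    (ha : Tendsto (fun n : ℕ => √(n : ℝ) * a n) atTop (𝓝 0)) : Tendsto a atTop (𝓝 0) := by
  refine squeeze_zero_norm' ?_ (tendsto_zero_iff_norm_tendsto_zero.1 ha)
  filter_upwards [eventually_ge_atTop 1] with n hn
  rw [norm_mul, Real.norm_of_nonneg (Real.sqrt_nonneg _)]
  exact le_mul_of_one_le_left (norm_nonneg _) (Real.one_le_sqrt.2 (by exact_mod_cast hn))

end RealEstimates

section EmpiricalFreq

variable {Ω β : Type*}

/-- The proportion of the first `n` observations of the sample `X` that lie in `s`. -/
noncomputable def empiricalFreq (X : ℕ → Ω → β) (n : ℕ) (s : Set β) (ω : Ω) : ℝ :=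
  1 / (n : ℝ) * ∑ i ∈ Finset.range n, s.indicator 1 (X i ω)

lemma abs_empiricalFreq_le_one (X : ℕ → Ω → β) (n : ℕ) (s : Set β) (ω : Ω) :
    |empiricalFreq X n s ω| ≤ 1 := by
  have h01 : ∀ i, |s.indicator (1 : β → ℝ) (X i ω) - 0| ≤ 1 := fun i => by
    by_cases hi : X i ω ∈ s <;> simp [hi]
  simpa [empiricalFreq] using abs_average_sub_average_le h01 n

variable [MeasurableSpace β] {μ : Measure β} {s : Set β}

lemma memLp_indicator_one [IsFiniteMeasure μ] (hs : MeasurableSet s) (p : ENNReal) :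
    MemLp (s.indicator (1 : β → ℝ)) p μ :=
  memLp_indicator_const p hs 1 (Or.inr (measure_ne_top μ s))

lemma variance_indicator_one [IsProbabilityMeasure μ] (hs : MeasurableSet s) :
    Var[s.indicator (1 : β → ℝ); μ] = μ.real s * (1 - μ.real s) := by
  have hsq : s.indicator (1 : β → ℝ) ^ 2 = s.indicator 1 := by
    ext z
    by_cases hz : z ∈ s <;> simp [hz]
  rw [variance_eq_sub (memLp_indicator_one hs 2), hsq, integral_indicator_one hs]
  ring

lemma tendstoInDistribution_empiricalFreq [MeasurableSpace Ω] {P : Measure Ω}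
    [IsProbabilityMeasure P] {X : ℕ → Ω → β} (hindep : iIndepFun X P)
    (hX : ∀ i, HasLaw (X i) μ P) (hs : MeasurableSet s) :
    TendstoInDistribution (fun (n : ℕ) ω => √(n : ℝ) * (empiricalFreq X n s ω - μ.real s))
      atTop (fun y : ℝ => y) (fun _ => P)
      (gaussianReal 0 (μ.real s * (1 - μ.real s)).toNNReal) := by
  have : IsProbabilityMeasure μ := (hX 0).isProbabilityMeasure_iff.1 inferInstance
  set φ : β → ℝ := s.indicator 1
  have hφ : Measurable φ := measurable_one.indicator hs
  have hmean : P[φ ∘ X 0] = μ.real s := by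
    rw [(hX 0).integral_comp hφ.aestronglyMeasurable, integral_indicator_one hs]
  have hvar : Var[φ ∘ X 0; P] = μ.real s * (1 - μ.real s) := by
    rw [← variance_map (by rw [(hX 0).map_eq]; exact hφ.aemeasurable) (hX 0).aemeasurable,
      (hX 0).map_eq, variance_indicator_one hs]
  have hclt := tendstoInDistribution_inv_sqrt_mul_sum_sub
    (P' := gaussianReal 0 (μ.real s * (1 - μ.real s)).toNNReal)
    (X := fun i => φ ∘ X i) (Y := fun y : ℝ => y)
    (by rw [hvar]; exact ⟨aemeasurable_id', Measure.map_id'⟩)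
    (MemLp.comp_of_map (by rw [(hX 0).map_eq]; exact memLp_indicator_one hs 2) (hX 0).aemeasurable)
    (hindep.comp (fun _ => φ) fun _ => hφ)
    (fun i => (IdentDistrib.mk (hX i).aemeasurable (hX 0).aemeasurable
      ((hX i).map_eq.trans (hX 0).map_eq.symm)).comp hφ)
  refine hclt.congr (fun n => ae_of_all _ fun ω => ?_) (ae_eq_refl _)
  rw [hmean]
  rcases Nat.eq_zero_or_pos n with rfl | hn
  · simp
  · have hinv : (√(n : ℝ))⁻¹ = √n * (1 / n) := by
      rw [mul_one_div, Real.sqrt_div_self', one_div]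
    have hn0 : (n : ℝ) ≠ 0 := by positivity
    simp only [hinv, empiricalFreq, Function.comp_apply, φ]
    field_simp

lemma tendstoInDistribution_of_eventually_norm_sub_le {E Ω' : Type*} [SeminormedAddCommGroup E]
    [SecondCountableTopology E] [MeasurableSpace E] [BorelSpace E] [MeasurableSpace Ω]
    [MeasurableSpace Ω'] {P : Measure Ω} [IsProbabilityMeasure P] {P' : Measure Ω'}
    [IsProbabilityMeasure P'] {Y Z : ℕ → Ω → E} {W : Ω' → E} {ε : ℕ → ℝ}
    (hZ : TendstoInDistribution Z atTop W (fun _ => P) P') (hY : ∀ n, AEMeasurable (Y n) P)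
    (hYZ : ∀ᵐ ω ∂P, ∀ᶠ n in atTop, ‖Y n ω - Z n ω‖ ≤ ε n) (hε : Tendsto ε atTop (𝓝 0)) :
    TendstoInDistribution Y atTop W (fun _ => P) P' := by
  refine tendstoInDistribution_of_tendstoInMeasure_sub _ _ hZ ?_ hY
  refine tendstoInMeasure_of_tendsto_ae
    (fun n => ((hY n).sub (hZ.forall_aemeasurable n)).aestronglyMeasurable) ?_
  filter_upwards [hYZ] with ω hω
  exact squeeze_zero_norm' hω hε

end EmpiricalFreq

section Estimator

variable {Ω : Type*} {T : Set ℝ} {S : ℝ → Set ℝ} {K : ℝ → ℝ → PMF ℝ} {h : ℕ → ℝ}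
  {X : ℕ → Ω → ℝ} {x : ℝ}

lemma fTilde_nonneg (K : ℝ → ℝ → PMF ℝ) (h : ℕ → ℝ) (X : ℕ → Ω → ℝ) (n : ℕ) (x : ℝ) (ω : Ω) :
    0 ≤ fTilde K h X n x ω :=
  mul_nonneg (by positivity) (Finset.sum_nonneg fun _ _ => ENNReal.toReal_nonneg)

lemma measurable_fTilde [MeasurableSpace Ω] (K : ℝ → ℝ → PMF ℝ) (h : ℕ → ℝ)
    (hX : ∀ i, Measurable (X i)) (n : ℕ) (x : ℝ) : Measurable (fTilde K h X n x) :=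
  (Finset.measurable_fun_sum _ fun i _ =>
    ((measurable_pmf (K x (h n))).comp (hX i)).ennreal_toReal).const_mul _

lemma measurable_normConst [MeasurableSpace Ω] (hT : T.Countable) (K : ℝ → ℝ → PMF ℝ) (h : ℕ → ℝ)
    (hX : ∀ i, Measurable (X i)) (n : ℕ) : Measurable (normConst T K h X n) := by
  have := hT.to_subtype
  have hC : normConst T K h X n =
      fun ω => (∑' y : T, ENNReal.ofReal (fTilde K h X n y ω)).toReal := by
    funext ω
    rw [ENNReal.tsum_toReal_eq fun _ => ENNReal.ofReal_ne_top]
    simp only [ENNReal.toReal_ofReal (fTilde_nonneg K h X n _ ω), normConst]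
  rw [hC]
  exact (Measurable.tsum fun y : T => (measurable_fTilde K h hX n y).ennreal_ofReal).ennreal_toReal

lemma measurable_fHat [MeasurableSpace Ω] (hT : T.Countable) (K : ℝ → ℝ → PMF ℝ) (h : ℕ → ℝ)
    (hX : ∀ i, Measurable (X i)) (n : ℕ) (x : ℝ) : Measurable (fHat T K h X n x) :=
  (measurable_fTilde K h hX n x).div (measurable_normConst hT K h hX n)

lemma abs_normConst_sub_one_le {n : ℕ} (hn : n ≠ 0) {ω : Ω} {F : ℝ}
    (hmass : ∀ i, Summable (fun y : T => (K y (h n) (X i ω)).toReal) ∧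
      |∑' y : T, (K y (h n) (X i ω)).toReal - 1| ≤ F) :
    |normConst T K h X n ω - 1| ≤ F := by
  have hC : normConst T K h X n ω =
      1 / (n : ℝ) * ∑ i ∈ Finset.range n, ∑' y : T, (K y (h n) (X i ω)).toReal := by
    unfold normConst fTilde
    rw [tsum_mul_left, Summable.tsum_finsetSum fun i _ => (hmass i).1]
  have hone : 1 / (n : ℝ) * ∑ _i ∈ Finset.range n, (1 : ℝ) = 1 := by
    simp [hn]
  simpa only [hC, hone] using abs_average_sub_average_le (fun i => (hmass i).2) n

lemma exists_abs_fHat_sub_empiricalFreq_le (hTS : UniformlyDiscrete T S) {D : ℕ → ℝ}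
    (hK : ∀ᶠ n in atTop, ∀ y ∈ T, (K y (h n)).support ⊆ S y)
    (hD : ∀ᶠ n in atTop, ∀ y ∈ T, SecondMomentLE (K y (h n)).toMeasure y (D n))
    (hD0 : Tendsto D atTop (𝓝 0)) (X : ℕ → Ω → ℝ) (hx : x ∈ T) :
    ∃ B : ℝ, ∀ᶠ n in atTop, ∀ ω, (∀ i, X i ω ∈ T) →
      |fHat T K h X n x ω - empiricalFreq X n {x} ω| ≤ B * D n := by
  obtain ⟨α, hα, hT, hS⟩ := hTS.exists_pairwise
  obtain ⟨C, hC⟩ := exists_tsum_inv_sub_sq_le hα hT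
  have hsmall : Tendsto (fun n => D n / α ^ 2 + D n * C) atTop (𝓝 0) := by
    simpa using (hD0.div_const (α ^ 2)).add (hD0.mul_const C)
  refine ⟨2 * (2 / α ^ 2 + C), ?_⟩
  filter_upwards [hK, hD, eventually_ne_atTop 0, hsmall.eventually_le_const one_half_pos]
    with n hKn hDn hn hsn ω hω
  have hdiag : ∀ y ∈ T, 1 - (K y (h n) y).toReal ≤ D n / α ^ 2 := fun y hy =>
    (hDn y hy).one_sub_apply_le hα fun z hz => hS y hy z (hKn y hy hz)
  have hD_nonneg : 0 ≤ D n := (integral_nonneg fun _ => sq_nonneg _).trans (hDn x hx).2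
  have hmass : ∀ i, Summable (fun y : T => (K y (h n) (X i ω)).toReal) ∧
      |∑' y : T, (K y (h n) (X i ω)).toReal - 1| ≤ D n / α ^ 2 + D n * C := fun i =>
    (summable_and_abs_tsum_apply_sub_one_le (k := fun y => K y (h n)) (hω i) (hC _ (hω i)).1
      (hdiag _ (hω i)) fun y hy hne => (hDn y hy).apply_le hne).imp_right fun hle =>
        hle.trans (by gcongr; exact (hC _ (hω i)).2)
  have hfTilde : |fTilde K h X n x ω - empiricalFreq X n {x} ω| ≤ D n / α ^ 2 :=
    abs_average_sub_average_le
      (fun i => (abs_apply_sub_indicator_le (K x (h n)) x (X i ω)).trans (hdiag x hx)) n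
  calc |fHat T K h X n x ω - empiricalFreq X n {x} ω|
      ≤ 2 * (D n / α ^ 2 + (D n / α ^ 2 + D n * C)) :=
        abs_div_sub_le (abs_empiricalFreq_le_one X n {x} ω) hfTilde
          (abs_normConst_sub_one_le hn hmass) hsn
    _ = 2 * (2 / α ^ 2 + C) * D n := by ring

lemma AssumptionA2.exists_secondMomentLE (hA2 : AssumptionA2 T S K h)
    (hpos : ∀ n, 1 ≤ n → 0 < h n) (hh : Tendsto h atTop (𝓝 0)) :
    ∃ M : ℝ, ∀ᶠ n in atTop, ∀ y ∈ T, SecondMomentLE (K y (h n)).toMeasure y (M * h n) := by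
  obtain ⟨c₁, hc₁⟩ := hA2.bias
  obtain ⟨c₂, hc₂⟩ := hA2.variance
  refine ⟨c₂ + c₁ ^ 2, ?_⟩
  filter_upwards [hc₁, hc₂, hA2.moment, eventually_ge_atTop 1, hh.eventually_le_const one_pos]
    with n hbias hvar hmem hn hn1 y hy
  refine (secondMomentLE_variance_add_sq (hmem y hy) y).mono ?_
  have hn0 : 0 ≤ h n := (hpos n hn).le
  calc kernelVar K y (h n) + (kernelMean K y (h n) - y) ^ 2
      ≤ c₂ * h n + (c₁ * h n) ^ 2 :=
        add_le_add (hvar y hy) (sq_le_sq.2 ((hbias y hy).trans (le_abs_self _)))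
    _ = c₂ * h n + c₁ ^ 2 * (h n * h n) := by ring
    _ ≤ c₂ * h n + c₁ ^ 2 * (1 * h n) := by gcongr
    _ = (c₂ + c₁ ^ 2) * h n := by ring

end Estimator

end DiscreteKernel

open DiscreteKernel in
theorem theorem2_general {Ω : Type*} [MeasurableSpace Ω] (P : Measure Ω) [IsProbabilityMeasure P]
    (T : Set ℝ) (S : ℝ → Set ℝ) (hTS : UniformlyDiscrete T S)
    (f : PMF ℝ) (hf : f.support ⊆ T)
    (X : ℕ → Ω → ℝ) (hX : ∀ i, Measurable (X i)) (hindep : iIndepFun X P)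
    (hlaw : ∀ i, P.map (X i) = f.toMeasure)
    (K : ℝ → ℝ → PMF ℝ) (h : ℕ → ℝ)
    (hK : ∀ᶠ n in atTop, ∀ y ∈ T, (K y (h n)).support ⊆ S y)
    (D : ℕ → ℝ) (hD : ∀ᶠ n in atTop, ∀ y ∈ T, SecondMomentLE (K y (h n)).toMeasure y (D n))
    (hrate : Tendsto (fun n : ℕ => √(n : ℝ) * D n) atTop (𝓝 0))
    (x : ℝ) (hx : x ∈ T) :
    TendstoInDistribution
      (fun (n : ℕ) (ω : Ω) => √(n : ℝ) * (fHat T K h X n x ω - (f x).toReal))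
      atTop (fun y : ℝ => y) (fun _ => P)
      (gaussianReal 0 (Real.toNNReal ((f x).toReal * (1 - (f x).toReal)))) := by
  have hXlaw : ∀ i, HasLaw (X i) f.toMeasure P := fun i => ⟨(hX i).aemeasurable, hlaw i⟩
  have hcountable : T.Countable := by
    obtain ⟨α, hα, hT, -⟩ := hTS.exists_pairwise
    exact countable_of_pairwise_le_abs_sub hα hT
  obtain ⟨B, hB⟩ := exists_abs_fHat_sub_empiricalFreq_le hTS hK hD
    (tendsto_zero_of_sqrt_mul_tendsto_zero hrate) X hx
  rw [← measureReal_toMeasure_singleton]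
  refine tendstoInDistribution_of_eventually_norm_sub_le (ε := fun n => B * (√(n : ℝ) * D n))
    (tendstoInDistribution_empiricalFreq hindep hXlaw (measurableSet_singleton x))
    (fun n => (((measurable_fHat hcountable K h hX n x).sub_const _).const_mul _).aemeasurable)
    ?_ (by simpa using hrate.const_mul B)
  filter_upwards [ae_forall_mem_of_support_subset hXlaw hf] with ω hω
  filter_upwards [hB] with n hn
  rw [← mul_sub, sub_sub_sub_cancel_right, norm_mul, Real.norm_of_nonneg (Real.sqrt_nonneg _),
    mul_left_comm B]
  exact mul_le_mul_of_nonneg_left (hn ω hω) (Real.sqrt_nonneg _)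

theorem theorem2 {Ω : Type*} [MeasurableSpace Ω] (P : Measure Ω) [IsProbabilityMeasure P]
    (T : Set ℝ) (S : ℝ → Set ℝ) (hTS : DiscreteKernel.UniformlyDiscrete T S)
    (f : PMF ℝ) (hf : f.support ⊆ T)
    (X : ℕ → Ω → ℝ) (hX : ∀ i, Measurable (X i)) (hindep : iIndepFun X P)
    (hlaw : ∀ i, P.map (X i) = f.toMeasure)
    (K : ℝ → ℝ → PMF ℝ) (hK : DiscreteKernel.IsKernelOn T S K)
    (h : ℕ → ℝ) (hpos : ∀ n, 1 ≤ n → 0 < h n)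
    (hA2 : DiscreteKernel.AssumptionA2 T S K h)
    (hrate : Tendsto (fun n : ℕ => √(n : ℝ) * h n) atTop (𝓝 0))
    (x : ℝ) (hx : x ∈ T) (hfx : 0 < f x) :
    TendstoInDistribution
      (fun (n : ℕ) (ω : Ω) =>
        √(n : ℝ) * (DiscreteKernel.fHat T K h X n x ω - (f x).toReal))
      atTop (fun y : ℝ => y) (fun _ => P)
      (gaussianReal 0 (Real.toNNReal ((f x).toReal * (1 - (f x).toReal)))) := by
  obtain ⟨M, hM⟩ := hA2.exists_secondMomentLE hpos
    (DiscreteKernel.tendsto_zero_of_sqrt_mul_tendsto_zero hrate)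
  exact theorem2_general P T S hTS f hf X hX hindep hlaw K h
    ((eventually_ge_atTop 1).mono fun n hn y hy => hK y hy _ (hpos n hn)) _ hM
    (by simpa [mul_left_comm] using hrate.const_mul M) x hx
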